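/- Let $\mathcal H$ be a complex Hilbert space with a fixed orthonormal basis $\{e_i\}$. For bounded operators $A,B$ on $\mathcal H$, let the Hadamard product $A\circ B$ be the bounded operator determined by $\langle (A\circ B)e_i,e_j\rangle=\langle Ae_i,e_j\rangle\langle Be_i,e_j\rangle$ for all $i,j$. Let $f:[0,\infty)\to\mathbb R$ be a continuous function that is super-multiplicative, i.e. $f(xy)\ge f(x)f(y)$ for all $x,y\ge 0$, and operator monotone, i.e. $A\le B$ implies $f(A)\le f(B)$ for all self-adjoint bounded operators $A,B$ with spectra in $[0,\infty)$ on any complex Hilbert space (here $\le$ is the Loewner order and $f(A)$ is given by the continuous functional calculus). Let $A_1\ge\cdots\ge A_n\ge 0$ and $B_1\ge\cdots\ge B_n\ge 0$ be bounded operators on $\mathcal H$, and let $\omega_1,\dots,\omega_n$ be positive real numbers. Then $$\Big(\sum_{j=1}^n\omega_j\Big)\sum_{j=1}^n\omega_j\, f(A_j\circ B_j)\;\ge\;\Big(\sum_{j=1}^n\omega_j f(A_j)\Big)\circ\Big(\sum_{j=1}^n\omega_j f(B_j)\Big).$$ -/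

import Mathlib

open scoped InnerProductSpace

universe u v

/-- `f` is operator monotone on `J`: it is continuous on `J`, and `A ≤ B` implies `f(A) ≤ f(B)` for
all self-adjoint bounded operators `A`, `B` with spectra in `J`, on every complex Hilbert space
(`≤` is the Loewner order, `f(A)` the continuous functional calculus). -/
def IsOperatorMonotoneOn (f : ℝ → ℝ) (J : Set ℝ) : Prop :=
  ContinuousOn f J ∧
    ∀ (K : Type u) [NormedAddCommGroup K] [InnerProductSpace ℂ K] [CompleteSpace K]
      (A B : K →L[ℂ] K), IsSelfAdjoint A → IsSelfAdjoint B →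
      spectrum ℝ A ⊆ J → spectrum ℝ B ⊆ J → A ≤ B → cfc f A ≤ cfc f B

/-- `f` is super-multiplicative on `J`. -/
def IsSuperMultiplicativeOn (f : ℝ → ℝ) (J : Set ℝ) : Prop :=
  ∀ x ∈ J, ∀ y ∈ J, f x * f y ≤ f (x * y)

section Hadamard

variable {ι : Type v} {H : Type u} [NormedAddCommGroup H] [InnerProductSpace ℂ H]

/-- Parseval's identity. -/
theorem HilbertBasis.hasSum_normSq_inner (b : HilbertBasis ι ℂ H) (x : H) :
    HasSum (fun i => ‖⟪b i, x⟫_ℂ‖ ^ 2) (‖x‖ ^ 2) := by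
  have h := b.hasSum_inner_mul_inner x x
  have h2 := Complex.hasSum_re h
  have e : (⟪x, x⟫_ℂ).re = ‖x‖ ^ 2 := by
    rw [inner_self_eq_norm_sq_to_K]; norm_cast
  rw [e] at h2
  convert h2 using 2 with i
  rw [← inner_conj_symm x (b i), ← Complex.normSq_eq_conj_mul_self, Complex.ofReal_re,
    Complex.normSq_eq_norm_sq]

variable [CompleteSpace H]

/-- The coordinatewise product of the `k`-th rows is bounded on `H`. -/
theorem hadamard_row (b : HilbertBasis ι ℂ H) (A B : H →L[ℂ] H) (k : ι) :
    ∃ w : H, (∀ i, ⟪w, b i⟫_ℂ = ⟪b k, A (b i)⟫_ℂ * ⟪b k, B (b i)⟫_ℂ) ∧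
      ∀ x, ‖⟪w, x⟫_ℂ‖ ^ 2 ≤
        ‖A‖ ^ 2 * ∑' i, ‖⟪b k, B (b i)⟫_ℂ‖ ^ 2 * ‖⟪b i, x⟫_ℂ‖ ^ 2 := by
  have hB : ∀ i, ‖⟪b k, B (b i)⟫_ℂ‖ ≤ ‖B‖ := fun i => by
    calc ‖⟪b k, B (b i)⟫_ℂ‖ ≤ ‖b k‖ * ‖B (b i)‖ := norm_inner_le_norm _ _
      _ ≤ 1 * (‖B‖ * 1) := by
          have h1 := b.orthonormal.1
          have := B.le_opNorm (b i)
          rw [h1 i] at this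
          rw [h1 k]; gcongr
      _ = ‖B‖ := by ring
  -- the diagonal multiplication of `x` by the `k`-th row of `B`
  have key : ∀ x : H, ∃ d : H, ∀ i, ⟪b i, d⟫_ℂ = ⟪b k, B (b i)⟫_ℂ * ⟪b i, x⟫_ℂ := fun x => by
    have hm : Memℓp (fun i => ⟪b k, B (b i)⟫_ℂ * ⟪b i, x⟫_ℂ) 2 := by
      refine memℓp_gen ?_
      refine Summable.of_nonneg_of_le (fun i => by positivity) (fun i => ?_)
        ((b.hasSum_normSq_inner x).summable.mul_left (‖B‖ ^ 2))
      simp only [ENNReal.toReal_ofNat, Real.rpow_ofNat, norm_mul, mul_pow]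
      gcongr
      exact hB i
    refine ⟨b.repr.symm ⟨_, hm⟩, fun i => ?_⟩
    rw [← b.repr_apply_apply, LinearIsometryEquiv.apply_symm_apply]
  have hconj : ∃ w : H, ∀ i, ⟪b i, w⟫_ℂ =
      starRingEnd ℂ (⟪b k, A (b i)⟫_ℂ * ⟪b k, B (b i)⟫_ℂ) := by
    have hm : Memℓp (fun i => starRingEnd ℂ (⟪b k, A (b i)⟫_ℂ * ⟪b k, B (b i)⟫_ℂ)) 2 := by
      refine memℓp_gen ?_
      refine Summable.of_nonneg_of_le (fun i => by positivity) (fun i => ?_)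
        ((b.hasSum_normSq_inner (ContinuousLinearMap.adjoint A (b k))).summable.mul_left
          (‖B‖ ^ 2))
      simp only [ENNReal.toReal_ofNat, Real.rpow_ofNat, RCLike.norm_conj, norm_mul, mul_pow]
      rw [ContinuousLinearMap.adjoint_inner_right, norm_inner_symm (A (b i)), mul_comm]
      gcongr
      exact hB i
    refine ⟨b.repr.symm ⟨_, hm⟩, fun i => ?_⟩
    rw [← b.repr_apply_apply, LinearIsometryEquiv.apply_symm_apply]
  obtain ⟨w, hw⟩ := hconj
  have hw' : ∀ i, ⟪w, b i⟫_ℂ = ⟪b k, A (b i)⟫_ℂ * ⟪b k, B (b i)⟫_ℂ := fun i => by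
    rw [← inner_conj_symm, hw, Complex.conj_conj]
  refine ⟨w, hw', fun x => ?_⟩
  obtain ⟨d, hd⟩ := key x
  have hsum : ⟪w, x⟫_ℂ = ⟪b k, A d⟫_ℂ := by
    rw [← ContinuousLinearMap.adjoint_inner_left, ← b.tsum_inner_mul_inner w x,
      ← b.tsum_inner_mul_inner _ d]
    refine tsum_congr fun i => ?_
    rw [hw', hd, ContinuousLinearMap.adjoint_inner_left]
    ring
  have hnd : ‖d‖ ^ 2 = ∑' i, ‖⟪b k, B (b i)⟫_ℂ‖ ^ 2 * ‖⟪b i, x⟫_ℂ‖ ^ 2 := by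
    rw [← (b.hasSum_normSq_inner d).tsum_eq]
    refine tsum_congr fun i => ?_
    rw [hd, norm_mul, mul_pow]
  rw [← hnd, hsum, ← mul_pow]
  gcongr
  calc ‖⟪b k, A d⟫_ℂ‖ ≤ ‖b k‖ * ‖A d‖ := norm_inner_le_norm _ _
    _ ≤ 1 * (‖A‖ * ‖d‖) := by
        rw [b.orthonormal.1 k]; gcongr; exact A.le_opNorm d
    _ = ‖A‖ * ‖d‖ := one_mul _

/-- There is exactly one bounded operator whose matrix in the orthonormal basis `b` is the
entrywise product of the matrices of `A` and `B`. -/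
theorem existsUnique_hadamard (b : HilbertBasis ι ℂ H) (A B : H →L[ℂ] H) :
    ∃! C : H →L[ℂ] H, ∀ i j,
      ⟪b j, C (b i)⟫_ℂ = ⟪b j, A (b i)⟫_ℂ * ⟪b j, B (b i)⟫_ℂ := by
  choose w hw hbd using hadamard_row b A B
  have hcol : ∀ i, HasSum (fun k => ‖⟪b k, B (b i)⟫_ℂ‖ ^ 2) (‖B (b i)‖ ^ 2) :=
    fun i => b.hasSum_normSq_inner _
  have hBi : ∀ i, ‖B (b i)‖ ≤ ‖B‖ := fun i => by
    simpa [b.orthonormal.1 i] using B.le_opNorm (b i)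
  -- finite partial sums of the squared coordinates are bounded
  have hfin : ∀ x (s : Finset ι), ∑ k ∈ s, ‖⟪w k, x⟫_ℂ‖ ^ 2 ≤ (‖A‖ * ‖B‖ * ‖x‖) ^ 2 := by
    intro x s
    have hx := b.hasSum_normSq_inner x
    have hsm : ∀ k, Summable fun i => ‖⟪b k, B (b i)⟫_ℂ‖ ^ 2 * ‖⟪b i, x⟫_ℂ‖ ^ 2 := fun k => by
      refine Summable.of_nonneg_of_le (fun i => by positivity) (fun i => ?_)
        (hx.summable.mul_left (‖B‖ ^ 2))
      gcongr
      calc ‖⟪b k, B (b i)⟫_ℂ‖ ≤ ‖b k‖ * ‖B (b i)‖ := norm_inner_le_norm _ _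
        _ ≤ 1 * ‖B‖ := by rw [b.orthonormal.1 k]; gcongr; exact hBi i
        _ = ‖B‖ := one_mul _
    calc ∑ k ∈ s, ‖⟪w k, x⟫_ℂ‖ ^ 2
        ≤ ∑ k ∈ s, ‖A‖ ^ 2 * ∑' i, ‖⟪b k, B (b i)⟫_ℂ‖ ^ 2 * ‖⟪b i, x⟫_ℂ‖ ^ 2 :=
          Finset.sum_le_sum fun k _ => hbd k x
      _ = ‖A‖ ^ 2 * ∑' i, ∑ k ∈ s, ‖⟪b k, B (b i)⟫_ℂ‖ ^ 2 * ‖⟪b i, x⟫_ℂ‖ ^ 2 := by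
          rw [← Finset.mul_sum, Summable.tsum_finsetSum fun k _ => hsm k]
      _ ≤ ‖A‖ ^ 2 * ∑' i, ‖B‖ ^ 2 * ‖⟪b i, x⟫_ℂ‖ ^ 2 := by
          refine mul_le_mul_of_nonneg_left ?_ (by positivity)
          refine Summable.tsum_le_tsum (fun i => ?_) (summable_sum fun k _ => hsm k)
            (hx.summable.mul_left _)
          rw [← Finset.sum_mul]
          gcongr
          calc ∑ k ∈ s, ‖⟪b k, B (b i)⟫_ℂ‖ ^ 2 ≤ ‖B (b i)‖ ^ 2 :=
                sum_le_hasSum s (fun k _ => by positivity) (hcol i)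
            _ ≤ ‖B‖ ^ 2 := by gcongr; exact hBi i
      _ = (‖A‖ * ‖B‖ * ‖x‖) ^ 2 := by rw [tsum_mul_left, hx.tsum_eq]; ring
  have hmem : ∀ x, Memℓp (fun k => ⟪w k, x⟫_ℂ) 2 := fun x => by
    refine memℓp_gen' (C := (‖A‖ * ‖B‖ * ‖x‖) ^ 2) fun s => ?_
    simpa using hfin x s
  let L : H →ₗ[ℂ] H :=
    { toFun := fun x => b.repr.symm ⟨_, hmem x⟩
      map_add' := fun x y => by
        rw [← map_add]; congr 1; ext k; exact inner_add_right _ _ _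
      map_smul' := fun c x => by
        rw [RingHom.id_apply, ← map_smul]; congr 1; ext k; exact inner_smul_right _ _ _ }
  have hL : ∀ x k, ⟪b k, L x⟫_ℂ = ⟪w k, x⟫_ℂ := fun x k => by
    rw [← b.repr_apply_apply]
    simp [L]
  have hLn : ∀ x, ‖L x‖ ≤ ‖A‖ * ‖B‖ * ‖x‖ := fun x => by
    refine le_of_sq_le_sq ?_ (by positivity)
    rw [← (b.hasSum_normSq_inner (L x)).tsum_eq]
    refine Real.tsum_le_of_sum_le (fun k => by positivity) fun s => ?_
    simpa [hL] using hfin x s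
  refine ⟨L.mkContinuous _ hLn, fun i j => ?_, fun C hC => ?_⟩
  · rw [LinearMap.mkContinuous_apply, hL, hw]
  · ext x
    refine b.repr.injective ?_
    ext j
    rw [b.repr_apply_apply, b.repr_apply_apply, LinearMap.mkContinuous_apply, hL,
      ← ContinuousLinearMap.adjoint_inner_left, ← b.tsum_inner_mul_inner _ x,
      ← b.tsum_inner_mul_inner (w j) x]
    refine tsum_congr fun i => ?_
    rw [ContinuousLinearMap.adjoint_inner_left, hC, hw]

/-- The Hadamard product `A ∘ B` with respect to the orthonormal basis `b`: the unique bounded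
operator whose matrix entries in `b` are the products of those of `A` and `B`. -/
noncomputable def hadamardProduct (b : HilbertBasis ι ℂ H) (A B : H →L[ℂ] H) : H →L[ℂ] H :=
  (existsUnique_hadamard b A B).choose

theorem inner_hadamardProduct (b : HilbertBasis ι ℂ H) (A B : H →L[ℂ] H) (i j : ι) :
    ⟪b j, hadamardProduct b A B (b i)⟫_ℂ = ⟪b j, A (b i)⟫_ℂ * ⟪b j, B (b i)⟫_ℂ :=
  (existsUnique_hadamard b A B).choose_spec.1 i j

end Hadamard

/-!
The Hadamard product is a compression of the tensor product: `A ∘ B = V† (A ⊗ B) V`, where `V` is the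
isometry `H → H ⊗ H` that maps each basis vector `e i` to `e i ⊗ e i`
(`hadamardProduct_eq_compression`). Since `A ⊗ B` is the product of the commuting operators `A ⊗ 1`
and `1 ⊗ B`, the Schur product theorem follows (`hadamardProduct_nonneg`).

For a single pair of positive operators, `f(A) ∘ f(B) ≤ f(A ∘ B)` (`hadamardProduct_cfc_le`) results
from two inequalities.
* `f(S) f(T) ≤ f(S T)` for commuting positive `S` and `T` (`Commute.cfc_mul_cfc_le`): on the
  characters of the commutative C⋆-algebra generated by `S` and `T` this is the super-multiplicativity
  of `f` on numbers. It is applied to `S = A ⊗ 1` and `T = 1 ⊗ B`, and `f(A ⊗ 1) = f(A) ⊗ 1` because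
  `A ↦ A ⊗ 1` is a ⋆-homomorphism.
* `V† f(X) V ≤ f(V† X V)` for positive `X` (`IsOperatorMonotoneOn.adjoint_comp_cfc_comp_le`). With
  `P = V V†` and `Q = 1 - P`, the operator `X` is at most `Z = (1 + ε) P X P + (1 + ε⁻¹) Q X Q` for
  every `ε > 0`. By monotonicity `f(X) ≤ f(Z)`, and `V† f(Z) V = f((1 + ε) V† X V)` because `Z`
  commutes with `P`; then `ε` tends to `0`.

Summed with the weights `ω j`, this leaves Chebyshev's inequality for the bilinear Hadamard product
(`LinearMap.chebyshev_sum`), whose hypothesis is that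
`(f(A i) - f(A j)) ∘ (f(B i) - f(B j))` is positive. Both factors have the same sign by monotonicity,
so this is the Schur product theorem.
-/

/-! ### Super-multiplicativity of the functional calculus on commuting elements -/

section CommutingCalculus

open WeakDual

/-- A character of a commutative C⋆-algebra takes a self-adjoint element to a point of its real
spectrum. -/
theorem WeakDual.CharacterSpace.exists_mem_spectrum_real_of_isSelfAdjoint {C : Type*}
    [CommCStarAlgebra C] (χ : characterSpace ℂ C) {s : C} (hs : IsSelfAdjoint s) :
    ∃ r ∈ spectrum ℝ s, χ s = algebraMap ℝ ℂ r := by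
  obtain ⟨r, hr⟩ : ∃ r : ℝ, χ s = algebraMap ℝ ℂ r :=
    ⟨(χ s).re, (Complex.conj_eq_iff_re.mp (hs.map χ)).symm⟩
  refine ⟨r, ?_, hr⟩
  rw [← spectrum.algebraMap_mem_iff ℂ, ← hr]
  exact AlgHom.apply_mem_spectrum χ s

theorem WeakDual.CharacterSpace.apply_cfc {C : Type*} [CommCStarAlgebra C]
    (χ : characterSpace ℂ C) {f : ℝ → ℝ} {s : C} {r : ℝ} (hs : IsSelfAdjoint s)
    (hf : ContinuousOn f (spectrum ℝ s)) (hr : χ s = algebraMap ℝ ℂ r) :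
    χ (cfc f s) = algebraMap ℝ ℂ (f r) := by
  rw [StarAlgHomClass.map_cfc χ f s hf (map_continuous χ) hs (hs.map χ), hr, cfc_algebraMap]

/-- The nonnegativity of `f(st) - f(s)f(t)` in a commutative C⋆-algebra, phrased through the spectrum
so that no order on the algebra is needed. -/
theorem spectrum_cfc_mul_sub_nonneg {C : Type*} [CommCStarAlgebra C] {f : ℝ → ℝ}
    (hf : ContinuousOn f (Set.Ici 0)) (hmul : IsSuperMultiplicativeOn f (Set.Ici 0)) {s t : C}
    (hs : IsSelfAdjoint s) (ht : IsSelfAdjoint t) (hs0 : spectrum ℝ s ⊆ Set.Ici 0)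
    (ht0 : spectrum ℝ t ⊆ Set.Ici 0) (hst0 : spectrum ℝ (s * t) ⊆ Set.Ici 0) :
    spectrum ℝ (cfc f (s * t) - cfc f s * cfc f t) ⊆ Set.Ici 0 := by
  intro x hx
  rw [← spectrum.algebraMap_mem_iff ℂ, CharacterSpace.mem_spectrum_iff_exists] at hx
  obtain ⟨χ, hχ⟩ := hx
  obtain ⟨p, hp, hp'⟩ := CharacterSpace.exists_mem_spectrum_real_of_isSelfAdjoint χ hs
  obtain ⟨q, hq, hq'⟩ := CharacterSpace.exists_mem_spectrum_real_of_isSelfAdjoint χ ht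
  have hpq : χ (s * t) = algebraMap ℝ ℂ (p * q) := by rw [map_mul, hp', hq', map_mul]
  rw [map_sub, map_mul, CharacterSpace.apply_cfc χ (hs.mul ht) (hf.mono hst0) hpq,
    CharacterSpace.apply_cfc χ hs (hf.mono hs0) hp', CharacterSpace.apply_cfc χ ht (hf.mono ht0) hq', ← map_mul, ← map_sub] at hχ
  rw [← (algebraMap ℝ ℂ).injective hχ]
  exact sub_nonneg.mpr (hmul p (hs0 hp) q (ht0 hq))

/-- Super-multiplicativity passes to the functional calculus of commuting positive elements. The
C⋆-algebra generated by them is commutative, so the inequality can be tested on its characters,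
where it is the scalar one. -/
theorem Commute.cfc_mul_cfc_le {A : Type*} [CStarAlgebra A] [PartialOrder A] [StarOrderedRing A]
    {f : ℝ → ℝ} (hf : ContinuousOn f (Set.Ici 0)) (hmul : IsSuperMultiplicativeOn f (Set.Ici 0))
    {a b : A} (hab : Commute a b) (ha : 0 ≤ a) (hb : 0 ≤ b) :
    cfc f a * cfc f b ≤ cfc f (a * b) := by
  have hspec : ∀ {x : A}, 0 ≤ x → spectrum ℝ x ⊆ Set.Ici 0 := fun hx _ hr =>
    spectrum_nonneg_of_nonneg hx hr
  have has := ha.isSelfAdjoint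
  have hbs := hb.isSelfAdjoint
  have hab0 : 0 ≤ a * b := hab.mul_nonneg ha hb
  let D := (StarAlgebra.adjoin ℂ {a, b}).topologicalClosure
  have hcomm : IsMulCommutative (StarAlgebra.adjoin ℂ ({a, b} : Set A)) := by
    have h1 : ∀ x ∈ ({a, b} : Set A), ∀ y ∈ ({a, b} : Set A), x * y = y * x := by
      rintro x (rfl | rfl) y (rfl | rfl)
      exacts [rfl, hab, hab.symm, rfl]
    refine StarAlgebra.isMulCommutative_adjoin ℂ h1 fun x hx y hy => ?_
    have hy' : star y = y := by rcases hy with rfl | rfl; exacts [has, hbs]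
    rw [hy']
    exact h1 x hx y hy
  have hD : IsClosed (D : Set A) := StarSubalgebra.isClosed_topologicalClosure _
  let : CommCStarAlgebra D :=
    { StarSubalgebra.cstarAlgebra D with
      mul_comm := (StarSubalgebra.commRingTopologicalClosure (StarAlgebra.adjoin ℂ {a, b})
        fun x y => hcomm.is_comm.comm x y).mul_comm }
  let φ : D →⋆ₐ[ℂ] A := D.subtype
  have hφ : Function.Injective φ := Subtype.val_injective
  have hφc : Continuous φ := continuous_subtype_val
  let s : D := ⟨a, StarSubalgebra.le_topologicalClosure _
    (StarAlgebra.subset_adjoin ℂ _ (by simp))⟩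
  let t : D := ⟨b, StarSubalgebra.le_topologicalClosure _
    (StarAlgebra.subset_adjoin ℂ _ (by simp))⟩
  have hs : IsSelfAdjoint s := Subtype.ext has
  have ht : IsSelfAdjoint t := Subtype.ext hbs
  have hφspec : ∀ {x : D}, IsSelfAdjoint x → 0 ≤ φ x → spectrum ℝ x ⊆ Set.Ici 0 :=
    fun hx h => by rw [← hx.map_spectrum_real φ hφ]; exact hspec h
  have hs0 := hφspec hs ha
  have ht0 := hφspec ht hb
  have hst0 := hφspec (hs.mul ht) hab0
  have key := spectrum_cfc_mul_sub_nonneg hf hmul hs ht hs0 ht0 hst0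
  have hX : IsSelfAdjoint (cfc f (s * t) - cfc f s * cfc f t) :=
    (IsSelfAdjoint.cfc (f := f)).sub ((IsSelfAdjoint.cfc (f := f)).mul (IsSelfAdjoint.cfc (f := f)))
  have hmap : φ (cfc f (s * t) - cfc f s * cfc f t) = cfc f (a * b) - cfc f a * cfc f b := by
    rw [map_sub, map_mul, φ.map_cfc f (s * t) (hf.mono hst0) hφc (hs.mul ht) ((hs.mul ht).map φ),
      φ.map_cfc f s (hf.mono hs0) hφc hs has, φ.map_cfc f t (hf.mono ht0) hφc ht hbs]
    rfl
  rw [← sub_nonneg, ← hmap, StarOrderedRing.nonneg_iff_spectrum_nonneg (R := ℝ) _ (hX.map φ),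
    hX.map_spectrum_real φ hφ]
  exact fun x hx => key hx

end CommutingCalculus

/-! ### Jensen's inequality for compressions -/

section Compression

open ContinuousLinearMap Filter Topology
open scoped InnerProduct

variable {H K : Type*} [NormedAddCommGroup H] [InnerProductSpace ℂ H] [CompleteSpace H]
  [NormedAddCommGroup K] [InnerProductSpace ℂ K] [CompleteSpace K]

/-- Compression along an isometry `V` commutes with the functional calculus on operators reduced by
the range of `V`, since it is a ⋆-homomorphism on the commutant of the range projection. -/
theorem ContinuousLinearMap.adjoint_comp_cfc_comp {V : H →L[ℂ] K} (hV : V† ∘L V = 1) {f : ℝ → ℝ}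
    {Z : K →L[ℂ] K} (hZ : IsSelfAdjoint Z) (hf : ContinuousOn f (spectrum ℝ Z))
    (hcomm : Commute Z (V ∘L V†)) :
    V† ∘L cfc f Z ∘L V = cfc f (V† ∘L Z ∘L V) := by
  have hV' : ∀ x, (V†) (V x) = x := fun x => congr($hV x)
  have hP : IsSelfAdjoint (V ∘L V†) := by
    rw [isSelfAdjoint_iff, star_eq_adjoint, adjoint_comp, adjoint_adjoint]
  let D := StarSubalgebra.centralizer ℂ {V ∘L V†}
  have hmemD : ∀ {Y : K →L[ℂ] K}, Y ∈ D ↔ Commute (V ∘L V†) Y := fun {Y} => by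
    simp [D, StarSubalgebra.mem_centralizer_iff, hP.star_eq, Commute, SemiconjBy]
  have hD : IsClosed (D : Set (K →L[ℂ] K)) := Set.isClosed_centralizer _
  let φ : D →⋆ₐ[ℂ] (H →L[ℂ] H) :=
    { toFun := fun Y => V† ∘L (Y : K →L[ℂ] K) ∘L V
      map_one' := hV
      map_mul' := fun X Y => by
        ext x
        have h : V ((V†) ((Y : K →L[ℂ] K) (V x))) = (Y : K →L[ℂ] K) (V ((V†) (V x))) :=
          congr($(hmemD.mp Y.2) (V x))
        simp [h, hV']
      map_zero' := by ext; simp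
      map_add' := fun X Y => by ext; simp
      commutes' := fun r => by
        ext x
        simp [Algebra.algebraMap_eq_smul_one, hV']
      map_star' := fun X => by
        simp [star_eq_adjoint, adjoint_comp, comp_assoc] }
  have hφc : Continuous φ := by
    change Continuous fun Y : D => V† ∘L (Y : K →L[ℂ] K) ∘L V
    fun_prop
  let ψ : D →⋆ₐ[ℂ] (K →L[ℂ] K) := D.subtype
  have hψ : Function.Injective ψ := Subtype.val_injective
  have hψc : Continuous ψ := continuous_subtype_val
  let z : D := ⟨Z, hmemD.mpr hcomm.symm⟩
  have hz : IsSelfAdjoint z := Subtype.ext hZ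
  have hfz : ContinuousOn f (spectrum ℝ z) := by
    rw [← hz.map_spectrum_real ψ hψ]; exact hf
  have h1 : φ (cfc f z) = cfc f (φ z) := φ.map_cfc f z hfz hφc hz (hz.map φ)
  have h2 : ψ (cfc f z) = cfc f Z := ψ.map_cfc f z hfz hψc hz hZ
  rw [← h2]
  exact h1

theorem ContinuousLinearMap.adjoint_comp_comp_mono (V : H →L[ℂ] K) {S T : K →L[ℂ] K}
    (h : S ≤ T) : V† ∘L S ∘L V ≤ V† ∘L T ∘L V := by
  rw [le_def] at h ⊢
  simpa [sub_comp, comp_sub] using h.adjoint_conj V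

/-- Pinching: a positive operator is dominated by its block-diagonal part with respect to a
projection, up to a factor that can be made arbitrarily close to `1` in one of the corners. -/
theorem le_smul_conjugate_add_smul_conjugate {A : Type*} [CStarAlgebra A] [PartialOrder A]
    [StarOrderedRing A] {a p : A} (ha : 0 ≤ a) (hp : IsSelfAdjoint p) {ε : ℝ} (hε : 0 < ε) :
    a ≤ (1 + ε) • (p * a * p) + (1 + ε⁻¹) • ((1 - p) * a * (1 - p)) := by
  set δ := √ε
  have hδ : δ ≠ 0 := (Real.sqrt_pos.mpr hε).ne'
  have hδ2 : δ * δ = ε := Real.mul_self_sqrt hε.le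
  have hc : IsSelfAdjoint (δ • p - δ⁻¹ • (1 - p)) :=
    ((IsSelfAdjoint.all δ).smul hp).sub ((IsSelfAdjoint.all δ⁻¹).smul ((IsSelfAdjoint.one A).sub hp))
  -- the difference of the two sides is `c * a * c` with `c = √ε p - (√ε)⁻¹ (1 - p)`
  have h := hc.conjugate_nonneg ha
  have hq : a = p * a * p + (1 - p) * a * p + p * a * (1 - p) + (1 - p) * a * (1 - p) := by
    noncomm_ring
  have e1 : δ * δ⁻¹ = 1 := mul_inv_cancel₀ hδ
  have e2 : δ⁻¹ * δ = 1 := inv_mul_cancel₀ hδ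
  have e3 : δ⁻¹ * δ⁻¹ = ε⁻¹ := by rw [← hδ2, mul_inv]
  have hexp : (δ • p - δ⁻¹ • (1 - p)) * a * (δ • p - δ⁻¹ • (1 - p)) =
      ε • (p * a * p) - (1 - p) * a * p - p * a * (1 - p) + ε⁻¹ • ((1 - p) * a * (1 - p)) := by
    generalize 1 - p = q
    simp only [sub_mul, mul_sub, smul_mul_assoc, mul_smul_comm, smul_sub, smul_smul, hδ2, e1, e2, e3,
      one_smul]
    abel
  rw [← sub_nonneg]
  convert h using 1
  rw [hexp]
  linear_combination (norm := module) (-1 : ℝ) • hq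

/-- The operator Jensen inequality for compressions to a subspace. A positive operator is dominated
by a multiple close to `1` of its compression plus an operator on the orthogonal complement, and on
such block-diagonal operators the compression commutes with the functional calculus. -/
theorem IsOperatorMonotoneOn.adjoint_comp_cfc_comp_le {H : Type v} {K : Type u}
    [NormedAddCommGroup H] [InnerProductSpace ℂ H] [CompleteSpace H]
    [NormedAddCommGroup K] [InnerProductSpace ℂ K] [CompleteSpace K] {f : ℝ → ℝ}
    (hf : IsOperatorMonotoneOn.{u} f (Set.Ici 0)) {V : H →L[ℂ] K} (hV : V† ∘L V = 1)
    {X : K →L[ℂ] K} (hX : 0 ≤ X) :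
    V† ∘L cfc f X ∘L V ≤ cfc f (V† ∘L X ∘L V) := by
  have hspec : ∀ {E : Type u} [NormedAddCommGroup E] [InnerProductSpace ℂ E] [CompleteSpace E]
      {S : E →L[ℂ] E}, 0 ≤ S → spectrum ℝ S ⊆ Set.Ici 0 := fun hS _ hr =>
    spectrum_nonneg_of_nonneg hS hr
  have hV' : ∀ x, (V†) (V x) = x := fun x => congr($hV x)
  set P := V ∘L V† with hPdef
  set T := V† ∘L X ∘L V with hTdef
  have hP : IsSelfAdjoint P := by
    rw [isSelfAdjoint_iff, star_eq_adjoint, adjoint_comp, adjoint_adjoint]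
  have hPP : P * P = P := by ext x; simp [P, hV']
  have hT : 0 ≤ T := by simpa using adjoint_comp_comp_mono V hX
  -- the inequality with `(1 + ε) • T` in place of `T`
  have key : ∀ ε : ℝ, 0 < ε → V† ∘L cfc f X ∘L V ≤ cfc f ((1 + ε) • T) := fun ε hε => by
    set Z := (1 + ε) • (P * X * P) + (1 + ε⁻¹) • ((1 - P) * X * (1 - P)) with hZdef
    have hXZ : X ≤ Z := le_smul_conjugate_add_smul_conjugate hX hP hε
    have hZ : 0 ≤ Z := hX.trans hXZ
    have hcomm : Commute Z P := by
      have h1 : (1 - P) * P = 0 := by rw [sub_mul, one_mul, hPP, sub_self]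
      have h2 : P * (1 - P) = 0 := by rw [mul_sub, mul_one, hPP, sub_self]
      simp only [Commute, SemiconjBy, Z, add_mul, mul_add, smul_mul_assoc, mul_smul_comm,
        mul_assoc, h1, hPP]
      simp only [← mul_assoc, h2, hPP, zero_mul, mul_zero]
    have hVZV : V† ∘L Z ∘L V = (1 + ε) • T := by
      ext x
      simp [Z, P, T, hV']
    rw [← hVZV, ← adjoint_comp_cfc_comp hV hZ.isSelfAdjoint (hf.1.mono (hspec hZ)) hcomm]
    exact adjoint_comp_comp_mono V (hf.2 K X Z hX.isSelfAdjoint hZ.isSelfAdjoint (hspec hX)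
      (hspec hZ) hXZ)
  have hlim : Tendsto (fun ε : ℝ => cfc f ((1 + ε) • T)) (𝓝[>] 0) (𝓝 (cfc f T)) := by
    have h0 : Tendsto (fun ε : ℝ => (1 + ε) • T) (𝓝[>] 0) (𝓝 T) := by
      have : Continuous fun ε : ℝ => (1 + ε) • T := by fun_prop
      simpa using (this.tendsto 0).mono_left nhdsWithin_le_nhds
    have hsmul : ∀ ε ∈ Set.Ioo (0 : ℝ) 1, 0 ≤ (1 + ε) • T := fun ε hε =>
      smul_nonneg (by linarith [hε.1]) hT
    have hIoo : ∀ᶠ ε : ℝ in 𝓝[>] 0, ε ∈ Set.Ioo (0 : ℝ) 1 := Ioo_mem_nhdsGT one_pos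
    have hbound : ∀ {S : H →L[ℂ] H}, 0 ≤ S → ‖S‖ ≤ 2 * ‖T‖ →
        spectrum ℝ S ⊆ Set.Icc 0 (2 * ‖T‖ * ‖(1 : H →L[ℂ] H)‖) := fun hS hST r hr =>
      ⟨spectrum_nonneg_of_nonneg hS hr, (Real.le_norm_self r).trans
        ((spectrum.norm_le_norm_mul_of_mem hr).trans (by gcongr))⟩
    refine h0.cfc isCompact_Icc f (hIoo.mono fun ε hε => hbound (hsmul ε hε) ?_)
      (hIoo.mono fun ε hε => (hsmul ε hε).isSelfAdjoint)
      (hbound hT (by linarith [norm_nonneg T])) hT.isSelfAdjoint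
      (hf.1.mono fun r hr => hr.1)
    rw [norm_smul, Real.norm_of_nonneg (by linarith [hε.1])]
    gcongr
    linarith [hε.2]
  exact ge_of_tendsto hlim (eventually_mem_nhdsWithin.mono fun ε hε => key ε hε)

end Compression

/-! ### The Hilbert space tensor product -/

section HilbertTensor

open ContinuousLinearMap UniformSpace TensorProduct
open scoped InnerProduct

/-- The completion of an inner product space, as a type synonym whose algebraic and topological
structure comes from its Hilbert space structure alone. -/
def HilbertCompletion (E : Type*) [NormedAddCommGroup E] [InnerProductSpace ℂ E] : Type _ :=
  Completion E

namespace HilbertCompletion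

variable (E : Type*) [NormedAddCommGroup E] [InnerProductSpace ℂ E]

noncomputable instance : NormedAddCommGroup (HilbertCompletion E) :=
  inferInstanceAs (NormedAddCommGroup (Completion E))

noncomputable instance : InnerProductSpace ℂ (HilbertCompletion E) :=
  inferInstanceAs (InnerProductSpace ℂ (Completion E))

instance : CompleteSpace (HilbertCompletion E) :=
  inferInstanceAs (CompleteSpace (Completion E))

/-- The isometric embedding of an inner product space into its completion. -/
noncomputable def embed : E →ₗᵢ[ℂ] HilbertCompletion E :=
  Completion.toComplₗᵢ (𝕜 := ℂ) (E := E)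

theorem denseRange_embed : DenseRange (embed E) :=
  Completion.denseRange_coe

variable {E}

theorem ext_of_embed {S T : HilbertCompletion E →L[ℂ] HilbertCompletion E}
    (h : ∀ x, S (embed E x) = T (embed E x)) : S = T :=
  ContinuousLinearMap.ext fun y => (denseRange_embed E).induction_on y
    (isClosed_eq S.continuous T.continuous) h

/-- The continuous extension of a bounded operator to the completion. -/
noncomputable def extendOperator (T : E →L[ℂ] E) : HilbertCompletion E →L[ℂ] HilbertCompletion E :=
  ((embed E).toContinuousLinearMap ∘L T).extend (embed E).toContinuousLinearMap

theorem extendOperator_embed (T : E →L[ℂ] E) (x : E) :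
    extendOperator T (embed E x) = embed E (T x) :=
  ContinuousLinearMap.extend_eq _ (e := (embed E).toContinuousLinearMap) (denseRange_embed E)
    (embed E).isometry.isUniformInducing x

/-- A ⋆-representation by bounded operators on an inner product space extends to the completion. The
adjoint of an operator need not exist on the inner product space itself, so the compatibility with
the star is expressed through the inner product. -/
noncomputable def extendRepresentation {𝒜 : Type*} [Ring 𝒜] [Algebra ℂ 𝒜] [Star 𝒜]
    (ρ : 𝒜 →ₐ[ℂ] (E →L[ℂ] E)) (hρ : ∀ a x y, ⟪ρ (star a) x, y⟫_ℂ = ⟪x, ρ a y⟫_ℂ) :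
    𝒜 →⋆ₐ[ℂ] (HilbertCompletion E →L[ℂ] HilbertCompletion E) where
  toFun a := extendOperator (ρ a)
  map_one' := ext_of_embed fun x => by simp [extendOperator_embed]
  map_mul' a b := ext_of_embed fun x => by simp [extendOperator_embed]
  map_zero' := ext_of_embed fun x => by simp [extendOperator_embed]
  map_add' a b := ext_of_embed fun x => by simp [extendOperator_embed]
  commutes' c := ext_of_embed fun x => by
    simp [extendOperator_embed, Algebra.algebraMap_eq_smul_one]
  map_star' a := by
    rw [star_eq_adjoint, eq_adjoint_iff]
    refine fun x y => (denseRange_embed E).induction_on₂ (p := fun x y =>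
      ⟪extendOperator (ρ (star a)) x, y⟫_ℂ = ⟪x, extendOperator (ρ a) y⟫_ℂ) ?_ ?_ x y
    · exact isClosed_eq (by fun_prop) (by fun_prop)
    · intro x y
      rw [extendOperator_embed, extendOperator_embed, LinearIsometry.inner_map_map,
        LinearIsometry.inner_map_map, hρ]

theorem extendRepresentation_embed {𝒜 : Type*} [Ring 𝒜] [Algebra ℂ 𝒜] [Star 𝒜]
    (ρ : 𝒜 →ₐ[ℂ] (E →L[ℂ] E)) (hρ : ∀ a x y, ⟪ρ (star a) x, y⟫_ℂ = ⟪x, ρ a y⟫_ℂ) (a : 𝒜) (x : E) :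
    extendRepresentation ρ hρ a (embed E x) = embed E (ρ a x) :=
  extendOperator_embed _ _

end HilbertCompletion

variable (H : Type u) [NormedAddCommGroup H] [InnerProductSpace ℂ H]

/-- The Hilbert space tensor product `H ⊗ H`, the completion of the algebraic tensor product. -/
abbrev HilbertTensor : Type u := HilbertCompletion (H ⊗[ℂ] H)

variable {H}

/-- The elementary tensor `x ⊗ y` in the Hilbert space tensor product. -/
noncomputable def HilbertTensor.tmul (x y : H) : HilbertTensor H :=
  HilbertCompletion.embed _ (x ⊗ₜ[ℂ] y)

theorem HilbertTensor.inner_tmul_tmul (x y x' y' : H) :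
    ⟪tmul x y, tmul x' y'⟫_ℂ = ⟪x, x'⟫_ℂ * ⟪y, y'⟫_ℂ := by
  rw [tmul, tmul, LinearIsometry.inner_map_map, TensorProduct.inner_tmul]

theorem HilbertTensor.ext_tmul {S T : HilbertTensor H →L[ℂ] HilbertTensor H}
    (h : ∀ x y, S (tmul x y) = T (tmul x y)) : S = T :=
  HilbertCompletion.ext_of_embed fun z => by
    induction z with
    | zero => simp only [map_zero]
    | add z w hz hw => simp only [map_add, hz, hw]
    | tmul x y => exact h x y

variable [CompleteSpace H]

theorem inner_rTensor_star_left (A : H →L[ℂ] H) (x y : H ⊗[ℂ] H) :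
    ⟪(star A).rTensor H x, y⟫_ℂ = ⟪x, A.rTensor H y⟫_ℂ := by
  induction x with
  | zero => simp
  | add x₁ x₂ h₁ h₂ => simp only [map_add, inner_add_left, h₁, h₂]
  | tmul x₁ x₂ =>
    induction y with
    | zero => simp
    | add y₁ y₂ h₁ h₂ => simp only [map_add, inner_add_right, h₁, h₂]
    | tmul y₁ y₂ => simp [-rTensor_apply, rTensor_tmul, adjoint_inner_left, star_eq_adjoint]

theorem inner_lTensor_star_left (A : H →L[ℂ] H) (x y : H ⊗[ℂ] H) :
    ⟪(star A).lTensor H x, y⟫_ℂ = ⟪x, A.lTensor H y⟫_ℂ := by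
  induction x with
  | zero => simp
  | add x₁ x₂ h₁ h₂ => simp only [map_add, inner_add_left, h₁, h₂]
  | tmul x₁ x₂ =>
    induction y with
    | zero => simp
    | add y₁ y₂ h₁ h₂ => simp only [map_add, inner_add_right, h₁, h₂]
    | tmul y₁ y₂ => simp [-lTensor_apply, lTensor_tmul, adjoint_inner_left, star_eq_adjoint]

/-- The representation `A ↦ A ⊗ 1` on `H ⊗ H`. -/
noncomputable def tensorLeft : (H →L[ℂ] H) →⋆ₐ[ℂ] (HilbertTensor H →L[ℂ] HilbertTensor H) :=
  HilbertCompletion.extendRepresentation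
    (AlgHom.ofLinearMap
      { toFun := fun A => A.rTensor H
        map_add' := rTensor_add H
        map_smul' := rTensor_smul H } (rTensor_one H) (rTensor_mul H))
    inner_rTensor_star_left

/-- The representation `A ↦ 1 ⊗ A` on `H ⊗ H`. -/
noncomputable def tensorRight : (H →L[ℂ] H) →⋆ₐ[ℂ] (HilbertTensor H →L[ℂ] HilbertTensor H) :=
  HilbertCompletion.extendRepresentation
    (AlgHom.ofLinearMap
      { toFun := fun A => A.lTensor H
        map_add' := lTensor_add H
        map_smul' := lTensor_smul H } (lTensor_one H) (lTensor_mul H))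
    inner_lTensor_star_left

theorem tensorLeft_tmul (A : H →L[ℂ] H) (x y : H) :
    tensorLeft A (HilbertTensor.tmul x y) = HilbertTensor.tmul (A x) y :=
  HilbertCompletion.extendRepresentation_embed _ _ _ _

theorem tensorRight_tmul (A : H →L[ℂ] H) (x y : H) :
    tensorRight A (HilbertTensor.tmul x y) = HilbertTensor.tmul x (A y) :=
  HilbertCompletion.extendRepresentation_embed _ _ _ _

theorem commute_tensorLeft_tensorRight (A B : H →L[ℂ] H) :
    Commute (tensorLeft A) (tensorRight B) :=
  HilbertTensor.ext_tmul fun x y => by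
    simp only [mul_def, comp_apply, tensorLeft_tmul, tensorRight_tmul]

/-! ### The Hadamard product as a compression of the tensor product -/

variable {ι : Type v} (b : HilbertBasis ι ℂ H)

omit [CompleteSpace H] in
theorem HilbertBasis.orthonormal_tmul_self :
    Orthonormal ℂ fun i => HilbertTensor.tmul (b i) (b i) := by
  classical
  rw [orthonormal_iff_ite]
  intro i j
  rw [HilbertTensor.inner_tmul_tmul, orthonormal_iff_ite.mp b.orthonormal]
  split_ifs <;> simp

/-- The isometry `H → H ⊗ H` with `b i ↦ b i ⊗ b i` for all `i`. -/
noncomputable def HilbertBasis.diagonalIsometry : H →ₗᵢ[ℂ] HilbertTensor H :=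
  b.orthonormal_tmul_self.orthogonalFamily.linearIsometry.comp b.repr.toLinearIsometry

omit [CompleteSpace H] in
theorem HilbertBasis.diagonalIsometry_apply_self (i : ι) :
    b.diagonalIsometry (b i) = HilbertTensor.tmul (b i) (b i) := by
  classical
  change b.orthonormal_tmul_self.orthogonalFamily.linearIsometry (b.repr (b i)) = _
  rw [b.repr_self, OrthogonalFamily.linearIsometry_apply_single, LinearIsometry.toSpanSingleton_apply, one_smul]

/-- The Hadamard product is the compression of the tensor product to the diagonal. -/
theorem hadamardProduct_eq_compression (A B : H →L[ℂ] H) :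
    hadamardProduct b A B = b.diagonalIsometry.toContinuousLinearMap† ∘L
      (tensorLeft A * tensorRight B) ∘L b.diagonalIsometry.toContinuousLinearMap := by
  refine (existsUnique_hadamard b A B).unique (inner_hadamardProduct b A B) fun i j => ?_
  rw [comp_apply, comp_apply, adjoint_inner_right, LinearIsometry.coe_toContinuousLinearMap,
    b.diagonalIsometry_apply_self, b.diagonalIsometry_apply_self, mul_def, comp_apply, tensorRight_tmul,
    tensorLeft_tmul, HilbertTensor.inner_tmul_tmul]

/-- The Schur product theorem: a Hadamard product of positive operators is positive, being a
compression of the product of the commuting positive operators `A ⊗ 1` and `1 ⊗ B`. -/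
theorem hadamardProduct_nonneg {A B : H →L[ℂ] H} (hA : 0 ≤ A) (hB : 0 ≤ B) :
    0 ≤ hadamardProduct b A B := by
  rw [hadamardProduct_eq_compression]
  have h := (commute_tensorLeft_tensorRight A B).mul_nonneg (map_nonneg tensorLeft hA)
    (map_nonneg tensorRight hB)
  simpa using adjoint_comp_comp_mono b.diagonalIsometry.toContinuousLinearMap h

/-- The case of a single pair of operators. Super-multiplicativity gives `f(A) ⊗ f(B) ≤ f(A ⊗ B)`,
and Jensen's inequality takes care of the compression to the diagonal. -/
theorem hadamardProduct_cfc_le {f : ℝ → ℝ} (hf_mul : IsSuperMultiplicativeOn f (Set.Ici 0))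
    (hf_mono : IsOperatorMonotoneOn.{u} f (Set.Ici 0)) {A B : H →L[ℂ] H} (hA : 0 ≤ A)
    (hB : 0 ≤ B) :
    hadamardProduct b (cfc f A) (cfc f B) ≤ cfc f (hadamardProduct b A B) := by
  have hL : 0 ≤ tensorLeft A := map_nonneg tensorLeft hA
  have hR : 0 ≤ tensorRight B := map_nonneg tensorRight hB
  have hcomm := commute_tensorLeft_tensorRight A B
  have hfA : tensorLeft (cfc f A) = cfc f (tensorLeft A) :=
    tensorLeft.map_cfc f A (hf_mono.1.mono fun _ hr => spectrum_nonneg_of_nonneg hA hr)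
      (map_continuous _) hA.isSelfAdjoint hL.isSelfAdjoint
  have hfB : tensorRight (cfc f B) = cfc f (tensorRight B) :=
    tensorRight.map_cfc f B (hf_mono.1.mono fun _ hr => spectrum_nonneg_of_nonneg hB hr)
      (map_continuous _) hB.isSelfAdjoint hR.isSelfAdjoint
  rw [hadamardProduct_eq_compression, hadamardProduct_eq_compression b A B, hfA, hfB]
  exact (adjoint_comp_comp_mono _ (hcomm.cfc_mul_cfc_le hf_mono.1 hf_mul hL hR)).trans
    (hf_mono.adjoint_comp_cfc_comp_le b.diagonalIsometry.adjoint_comp_self (hcomm.mul_nonneg hL hR))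

/-- The Hadamard product as a real bilinear map. -/
noncomputable def hadamardBilinear :
    (H →L[ℂ] H) →ₗ[ℝ] (H →L[ℂ] H) →ₗ[ℝ] (H →L[ℂ] H) :=
  LinearMap.mk₂ ℝ (hadamardProduct b)
    (fun A A' B => by
      simp only [hadamardProduct_eq_compression, map_add, add_mul, add_comp, comp_add])
    (fun c A B => by
      simp only [hadamardProduct_eq_compression, ← Complex.coe_smul, map_smul, smul_mul_assoc,
        smul_comp, comp_smul])
    (fun A B B' => by
      simp only [hadamardProduct_eq_compression, map_add, mul_add, add_comp, comp_add])
    (fun c A B => by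
      simp only [hadamardProduct_eq_compression, ← Complex.coe_smul, map_smul, mul_smul_comm,
        smul_comp, comp_smul])

end HilbertTensor

/-! ### Chebyshev's inequality for Hadamard products -/

/-- Chebyshev's sum inequality for a bilinear map in place of the product. -/
theorem LinearMap.chebyshev_sum {ι M N P : Type*} [Fintype ι] [AddCommGroup M] [Module ℝ M]
    [AddCommGroup N] [Module ℝ N] [AddCommGroup P] [Module ℝ P] [PartialOrder P]
    [IsOrderedAddMonoid P] [PosSMulMono ℝ P] (β : M →ₗ[ℝ] N →ₗ[ℝ] P) {x : ι → M} {y : ι → N}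
    {w : ι → ℝ} (hw : ∀ i, 0 ≤ w i) (h : ∀ i j, 0 ≤ β (x i - x j) (y i - y j)) :
    β (∑ i, w i • x i) (∑ i, w i • y i) ≤ (∑ i, w i) • ∑ i, w i • β (x i) (y i) := by
  set L := β (∑ i, w i • x i) (∑ i, w i • y i) with hL
  set R := (∑ i, w i) • ∑ i, w i • β (x i) (y i) with hR
  have hnonneg : 0 ≤ ∑ i, ∑ j, (w i * w j) • β (x i - x j) (y i - y j) :=
    Finset.sum_nonneg fun i _ => Finset.sum_nonneg fun j _ =>
      smul_nonneg (mul_nonneg (hw i) (hw j)) (h i j)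
  have hL' : ∑ i, ∑ j, (w i * w j) • β (x i) (y j) = L := by
    simp only [hL, map_sum, map_smul, LinearMap.sum_apply, LinearMap.smul_apply, Finset.smul_sum,
      smul_smul]
    rw [Finset.sum_comm]
    simp only [mul_comm]
  have hR' : ∑ i, ∑ j, (w i * w j) • β (x j) (y j) = R := by
    rw [hR, Finset.sum_smul]
    simp only [Finset.smul_sum, smul_smul]
  -- the terms with both arguments of `β` at the same index give `R`, the mixed ones give `L`
  have hsum : ∑ i, ∑ j, (w i * w j) • β (x i - x j) (y i - y j) = (2 : ℝ) • (R - L) := by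
    have e1 : ∑ i, ∑ j, (w i * w j) • β (x j) (y i) = L := by
      rw [← hL', Finset.sum_comm]; simp only [mul_comm]
    have e2 : ∑ i, ∑ j, (w i * w j) • β (x i) (y i) = R := by
      rw [← hR', Finset.sum_comm]; simp only [mul_comm]
    simp only [map_sub, LinearMap.sub_apply, smul_sub, Finset.sum_sub_distrib, hL', hR', e1, e2]
    module
  rw [hsum] at hnonneg
  have := smul_nonneg (by norm_num : (0 : ℝ) ≤ 1 / 2) hnonneg
  rw [smul_smul] at this
  norm_num at this
  exact this

theorem mainTheorem8 {ι : Type v} {H : Type u} [NormedAddCommGroup H] [InnerProductSpace ℂ H]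
    [CompleteSpace H] (b : HilbertBasis ι ℂ H) (f : ℝ → ℝ)
    (hf_mul : IsSuperMultiplicativeOn f (Set.Ici 0))
    (hf_mono : IsOperatorMonotoneOn.{u} f (Set.Ici 0))
    (n : ℕ) (A B : Fin n → (H →L[ℂ] H)) (ω : Fin n → ℝ)
    (hA : Antitone A) (hA_nonneg : ∀ j, 0 ≤ A j)
    (hB : Antitone B) (hB_nonneg : ∀ j, 0 ≤ B j)
    (hω : ∀ j, 0 < ω j) :
    hadamardProduct b (∑ j, ω j • cfc f (A j)) (∑ j, ω j • cfc f (B j)) ≤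
      (∑ j, ω j) • ∑ j, ω j • cfc f (hadamardProduct b (A j) (B j)) := by
  have hanti : ∀ {C : Fin n → (H →L[ℂ] H)}, Antitone C → (∀ j, 0 ≤ C j) →
      Antitone fun j => cfc f (C j) := fun {C} hC hC0 i j hij =>
    hf_mono.2 H (C j) (C i) (hC0 j).isSelfAdjoint (hC0 i).isSelfAdjoint
      (fun _ hr => spectrum_nonneg_of_nonneg (hC0 j) hr)
      (fun _ hr => spectrum_nonneg_of_nonneg (hC0 i) hr) (hC hij)
  have hfA := hanti hA hA_nonneg
  have hfB := hanti hB hB_nonneg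
  refine ((hadamardBilinear b).chebyshev_sum (fun j => (hω j).le) fun i j => ?_).trans ?_
  · -- `f(A i) - f(A j)` and `f(B i) - f(B j)` have the same sign
    change 0 ≤ hadamardProduct b _ _
    rcases le_total i j with hij | hij
    · exact hadamardProduct_nonneg b (sub_nonneg.mpr (hfA hij)) (sub_nonneg.mpr (hfB hij))
    · have h := hadamardProduct_nonneg b (sub_nonneg.mpr (hfA hij)) (sub_nonneg.mpr (hfB hij))
      change 0 ≤ hadamardBilinear b _ _ at h ⊢
      rw [← neg_sub, ← neg_sub (cfc f (B j)), map_neg, map_neg, LinearMap.neg_apply, neg_neg]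
      exact h
  · refine smul_le_smul_of_nonneg_left (Finset.sum_le_sum fun j _ => ?_)
      (Finset.sum_nonneg fun j _ => (hω j).le)
    exact smul_le_smul_of_nonneg_left
      (hadamardProduct_cfc_le b hf_mul hf_mono (hA_nonneg j) (hB_nonneg j)) (hω j).le
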